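/- All rings are commutative with $1$ and all monoids are commutative, written multiplicatively. Let $A \subset B$ be an extension of reduced rings and $M \subset N$ an extension of affine monoids (finitely generated, cancellative monoids in which $x^n=y^n$ with $n\ge 1$ implies $x=y$). An extension of rings $R\subset S$ is called subintegral if $S$ is integral over $R$, the map $\operatorname{Spec} S\to\operatorname{Spec} R$ is bijective, and for every $Q\in \operatorname{Spec} S$ the residue field extension $k(R\cap Q)\to k(Q)$ is an isomorphism. A subring $R$ of a ring $S$ is subintegrally closed in $S$ if $R$ is the largest subring $C$ with $R\subset C\subset S$ such that $R\subset C$ is subintegral. The submonoid $M$ is subintegrally closed in $N$ if every $x\in N$ with $x^2,x^3\in M$ lies in $M$. Suppose that $A$ is subintegrally closed in $B$ and that $M$ is subintegrally closed in $N$. Let $I\subset N$ be a radical ideal of $N$, i.e. a (possibly empty) subset with $IN\subset I$ and $I=\{x\in N : x^n\in I \text{ for some } n\ge 1\}$. Let $IB[N]$ denote the ideal of the monoid algebra $B[N]$ generated by $I$, and $(I\cap M)A[M]$ the ideal of $A[M]$ generated by $I\cap M$. Then the natural map $$\frac{A[M]}{(I\cap M)A[M]}\longrightarrow\frac{B[N]}{IB[N]}$$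 is injective, and (its image, identified with) $\frac{A[M]}{(I\cap M)A[M]}$ is subintegrally closed in $\frac{B[N]}{IB[N]}$. -/

import Mathlib

/-- An injective homomorphism of commutative rings `f : R → S` (an extension `R ⊂ S`) is
*subintegral* if `S` is integral over `R`, the map `Spec S → Spec R` is bijective, and all the
induced extensions of residue fields `κ(f⁻¹ Q) → κ(Q)`, `Q ∈ Spec S`, are isomorphisms. -/
structure RingHom.IsSubintegral {R S : Type*} [CommRing R] [CommRing S] (f : R →+* S) : Prop where
  injective : Function.Injective f
  isIntegral : f.IsIntegral
  bijective_comap : Function.Bijective (PrimeSpectrum.comap f)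
  bijective_residueField : ∀ (Q : Ideal S) [Q.IsPrime],
    Function.Bijective (Ideal.ResidueField.map (Q.comap f) Q f rfl)

/-- The set of subrings `C` with `A ⊂ C ⊂ B` such that the extension `A ⊂ C` is subintegral. -/
def Subring.subintegralExtensions {B : Type*} [CommRing B] (A : Subring B) : Set (Subring B) :=
  {C | ∃ h : A ≤ C, (Subring.inclusion h).IsSubintegral}

/-- A subring `A` of `B` is *subintegrally closed* in `B` if the subintegral closure of `A` in `B`,
i.e. the largest subintegral extension of `A` inside `B`, is `A` itself. -/
def Subring.IsSubintegrallyClosed {B : Type*} [CommRing B] (A : Subring B) : Prop :=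
  IsGreatest A.subintegralExtensions A

/-- A submonoid `M` of `N` is *subintegrally closed* in `N` if every `x ∈ N` with `x², x³ ∈ M`
lies in `M`. -/
def Submonoid.IsSubintegrallyClosed {N : Type*} [CommMonoid N] (M : Submonoid N) : Prop :=
  ∀ x : N, x ^ 2 ∈ M → x ^ 3 ∈ M → x ∈ M

namespace SemigroupIdeal

/-- The radical `{x | xⁿ ∈ I for some n ≥ 1}` of an ideal of a commutative monoid, as a set. -/
def rad {N : Type*} [CommMonoid N] (I : SemigroupIdeal N) : Set N :=
  {x | ∃ n : ℕ, 1 ≤ n ∧ x ^ n ∈ I}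

/-- A monoid ideal is a *radical ideal* if it equals its radical. -/
def IsRadicalIdeal {N : Type*} [CommMonoid N] (I : SemigroupIdeal N) : Prop :=
  (I : Set N) = I.rad

/-- The ideal `I ∩ M` of the submonoid `M`, for an ideal `I` of `N`. -/
def restrict {N : Type*} [CommMonoid N] (I : SemigroupIdeal N) (M : Submonoid N) :
    SemigroupIdeal M where
  carrier := Subtype.val ⁻¹' (I : Set N)
  smul_mem' c _ hx := SemigroupIdeal.mul_mem I (c : N) hx

/-- The ideal `I R[N]` of the monoid algebra `R[N]` generated by a monoid ideal `I` of `N`. -/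
noncomputable def algebraIdeal (R : Type*) [CommRing R] {N : Type*} [CommMonoid N]
    (I : SemigroupIdeal N) : Ideal (MonoidAlgebra R N) :=
  Ideal.span (MonoidAlgebra.of R N '' (I : Set N))

end SemigroupIdeal

/-- The natural inclusion `A[M] → B[N]`, `∑ aₘ m ↦ ∑ aₘ m`. -/
noncomputable def monoidAlgebraInclusion {B N : Type*} [CommRing B] [CommMonoid N]
    (A : Subring B) (M : Submonoid N) : MonoidAlgebra A M →+* MonoidAlgebra B N :=
  (MonoidAlgebra.mapDomainRingHom B M.subtype).comp (MonoidAlgebra.mapRingHom M A.subtype)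

theorem algebraIdeal_restrict_le_comap {B N : Type*} [CommRing B] [CommMonoid N]
    (A : Subring B) (M : Submonoid N) (I : SemigroupIdeal N) :
    (I.restrict M).algebraIdeal A ≤
      (I.algebraIdeal B).comap (monoidAlgebraInclusion A M) := by
  refine Ideal.span_le.mpr ?_
  rintro _ ⟨m, hm, rfl⟩
  refine Ideal.subset_span ⟨(m : N), hm, ?_⟩
  simp [monoidAlgebraInclusion]

/-- The natural map `A[M] / (I ∩ M) A[M] → B[N] / I B[N]` induced by `A[M] ⊂ B[N]`. -/
noncomputable def monoidQuotientMap {B N : Type*} [CommRing B] [CommMonoid N]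
    (A : Subring B) (M : Submonoid N) (I : SemigroupIdeal N) :
    MonoidAlgebra A M ⧸ (I.restrict M).algebraIdeal A →+* MonoidAlgebra B N ⧸ I.algebraIdeal B :=
  Ideal.quotientMap (I.algebraIdeal B) (monoidAlgebraInclusion A M)
    (algebraIdeal_restrict_le_comap A M I)

/-! The conclusion follows from a square-cube criterion: if `x ^ 2, x ^ 3 ∈ R` always forces `x ∈
R`, then `R` has no proper subintegral extension in `S`. To verify it in the quotient, take `n ∉ I`.
As `I` is radical, the smallest face of `N` containing `n` misses `I`, so projecting `B[N]` onto
that face kills `I B[N]`. This reduces everything to the case of empty `I`: if `f²` and `f³` lie in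
`A[M]`, so does `f`.

The coefficients of `f` lie in `A` because adjoining them to `A` is a subintegral extension. They
are integral by a Gauss-type argument over valuation rings. Residue fields do not grow and primes do
not split because, over a field `K`, the algebra `K[N]` is a domain, where `f` is determined by `f²`
and `f³`.

The support of `f` lies in `M`: reducing modulo a prime that avoids a given coefficient, the
coefficient ring may be taken to be a domain. Integrality, applied after the comultiplication `n ↦ n
⊗ n`, puts a power of each support element in `M`. A conductor argument at a suitable face of `M`
then finishes. -/

/-! ### The image of `A[M]` in `B[N]`. -/

theorem coeff_monoidAlgebraInclusion {B N : Type*} [CommRing B] [CommMonoid N]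
    (A : Subring B) (M : Submonoid N) (g : MonoidAlgebra A M) (m : M) :
    (monoidAlgebraInclusion A M g).coeff m = (g.coeff m : B) := by
  have := Finsupp.mapDomain_apply (f := M.subtype) Subtype.val_injective
    (MonoidAlgebra.map A.subtype.toAddMonoidHom g).coeff m
  simpa only [monoidAlgebraInclusion] using! this

theorem mem_range_monoidAlgebraInclusion {B N : Type*} [CommRing B] [CommMonoid N]
    {A : Subring B} {M : Submonoid N} {f : MonoidAlgebra B N} :
    f ∈ (monoidAlgebraInclusion A M).range ↔
      ∀ n, f.coeff n ∈ A ∧ (f.coeff n ≠ 0 → n ∈ M) := by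
  classical
  constructor
  · rintro ⟨g, rfl⟩ n
    by_cases hn : n ∈ M
    · have := coeff_monoidAlgebraInclusion A M g ⟨n, hn⟩
      exact ⟨this ▸ (g.coeff ⟨n, hn⟩).2, fun _ => hn⟩
    · have : ((monoidAlgebraInclusion A M) g).coeff n = 0 :=
        Finsupp.mapDomain_of_notMem_range _ _ (by simpa using hn)
      exact ⟨this ▸ A.zero_mem, fun h => (h this).elim⟩
  · intro h
    have hf : f = ∑ n ∈ f.coeff.support, MonoidAlgebra.single n (f.coeff n) := by
      ext m
      simp [MonoidAlgebra.coeff_sum, Finsupp.single_apply]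
    rw [hf]
    refine sum_mem fun n hn => ?_
    refine ⟨MonoidAlgebra.single ⟨n, (h n).2 (Finsupp.mem_support_iff.1 hn)⟩ ⟨_, (h n).1⟩, ?_⟩
    simp [monoidAlgebraInclusion]

/-! ### Integrality of coefficients and powers of support elements. -/

/-- Gauss's lemma in disguise: otherwise divide `f` by a coefficient `b` of largest valuation, which
exceeds 1. The result has coefficients in `V`, one of them equal to 1, yet its square vanishes over
the residue field, whose monoid algebra is a domain. -/
theorem ValuationSubring.coeff_mem_of_coeff_sq_mem {L N : Type*} [Field L] [CommMonoid N]
    [UniqueProds N] (V : ValuationSubring L) (f : MonoidAlgebra L N)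
    (h : ∀ n, (f ^ 2).coeff n ∈ V) (n : N) : f.coeff n ∈ V := by
  by_contra hn
  have hn0 : n ∈ f.coeff.support := by
    rw [Finsupp.mem_support_iff]
    intro h0
    exact hn (h0 ▸ V.zero_mem)
  obtain ⟨m, hm, hmax⟩ := Finset.exists_max_image f.coeff.support
    (fun i => V.valuation (f.coeff i)) ⟨n, hn0⟩
  have hb0 : f.coeff m ≠ 0 := Finsupp.mem_support_iff.1 hm
  set b := f.coeff m with hb
  have hb1 : 1 < V.valuation b := by
    refine lt_of_lt_of_le ?_ (hmax n hn0)
    rwa [← not_le, V.valuation_le_one_iff]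
  have hmem : ∀ i, (b⁻¹ • f).coeff i ∈ Set.range V.subtype := by
    intro i
    refine ⟨⟨b⁻¹ * f.coeff i, ?_⟩, by simp⟩
    rw [← V.valuation_le_one_iff, map_mul, map_inv₀]
    by_cases hi : i ∈ f.coeff.support
    · exact inv_mul_le_one_of_le₀ (hmax i hi) zero_le
    · simp [Finsupp.notMem_support_iff.1 hi]
  obtain ⟨g, hg⟩ : b⁻¹ • f ∈ Set.range (MonoidAlgebra.map (M := N) V.subtype.toAddMonoidHom) := by
    rw [MonoidAlgebra.range_map]
    exact hmem
  have hg' : ∀ i, ((g.coeff i : V) : L) = b⁻¹ * f.coeff i := by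
    intro i
    have := congrArg (fun q => MonoidAlgebra.coeff q i) hg
    simpa using! this
  have hg2 : ∀ i, (((g ^ 2).coeff i : V) : L) = (b ^ 2)⁻¹ * (f ^ 2).coeff i := by
    intro i
    have h1 : MonoidAlgebra.mapRingHom N V.subtype (g ^ 2) = (b ^ 2)⁻¹ • f ^ 2 := by
      rw [map_pow]
      have : MonoidAlgebra.mapRingHom N V.subtype g = b⁻¹ • f := hg
      rw [this, smul_pow, inv_pow]
    have := congrArg (fun q => MonoidAlgebra.coeff q i) h1
    rwa [MonoidAlgebra.coeff_mapRingHom] at this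
  have hz : MonoidAlgebra.mapRingHom N (IsLocalRing.residue V) g ^ 2 = 0 := by
    rw [← map_pow]
    ext i
    rw [MonoidAlgebra.coeff_mapRingHom]
    simp only [MonoidAlgebra.coeff_zero, Finsupp.coe_zero, Pi.zero_apply]
    rw [IsLocalRing.residue_eq_zero_iff]
    refine (V.valuation_lt_one_iff _).2 ?_
    rw [hg2, map_mul, map_inv₀, map_pow]
    have : V.valuation ((f ^ 2).coeff i) ≤ 1 := (V.valuation_le_one_iff _).2 (h i)
    calc _ ≤ (V.valuation b ^ 2)⁻¹ * 1 := by gcongr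
      _ < 1 := by
        rw [mul_one]
        exact inv_lt_one_of_one_lt₀ (one_lt_pow₀ hb1 two_ne_zero)
  have hz' := congrArg (fun q => MonoidAlgebra.coeff q m) (pow_eq_zero_iff (two_ne_zero) |>.1 hz)
  simp only [MonoidAlgebra.coeff_mapRingHom] at hz'
  have h1 : g.coeff m = 1 := by
    apply Subtype.ext
    rw [hg' m, ← hb, inv_mul_cancel₀ hb0]
    rfl
  rw [h1] at hz'
  simp at hz'

/-- The integral closure of `A` in `L` is the intersection of the valuation rings containing `A`. -/
theorem MonoidAlgebra.isIntegral_coeff_of_coeff_sq_mem {L N : Type*} [Field L] [CommMonoid N]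
    [UniqueProds N] (A : Subring L) (f : MonoidAlgebra L N)
    (h : ∀ n, (f ^ 2).coeff n ∈ A) (n : N) : IsIntegral A (f.coeff n) := by
  have key : f.coeff n ∈
      (⨅ V : {V : ValuationSubring L // (A : Set L) ⊆ V.toSubring}, V.1.toSubring) := by
    rw [Subring.mem_iInf]
    intro V
    exact V.1.coeff_mem_of_coeff_sq_mem f (fun m => V.2 (h m)) n
  rw [iInf_valuationSubring_superset] at key
  have key' : IsIntegral (Subring.closure (A : Set L)) (f.coeff n) := key
  rwa [Subring.closure_eq] at key'

/-- Integrality over a subring can be checked modulo every prime ideal. -/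
theorem isIntegral_of_forall_prime {B : Type*} [CommRing B] (A : Subring B) (b : B)
    (h : ∀ q : Ideal B, q.IsPrime → ∃ p : Polynomial A, p.Monic ∧ Polynomial.aeval b p ∈ q) :
    IsIntegral A b := by
  let S : Submonoid B :=
    { carrier := {x | ∃ p : Polynomial A, p.Monic ∧ Polynomial.aeval b p = x}
      one_mem' := ⟨1, Polynomial.monic_one, map_one _⟩
      mul_mem' := by
        rintro _ _ ⟨p, hp, rfl⟩ ⟨q, hq, rfl⟩
        exact ⟨p * q, hp.mul hq, map_mul _ _ _⟩ }
  by_cases h0 : (0 : B) ∈ S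
  · obtain ⟨p, hp, hp0⟩ := h0
    exact ⟨p, hp, hp0⟩
  · obtain ⟨q, hq, -, hdis⟩ := Ideal.exists_le_prime_disjoint (⊥ : Ideal B) S (by
      rw [Set.disjoint_left]
      rintro x hx hxS
      rw [SetLike.mem_coe, Ideal.mem_bot] at hx
      exact h0 (hx ▸ hxS))
    obtain ⟨p, hp, hpq⟩ := h q hq
    exact (Set.disjoint_left.1 hdis hpq ⟨p, hp, rfl⟩).elim

/-- The coefficients of an element of `B[N]` whose square lies in `A[N]` are integral over `A`. -/
theorem MonoidAlgebra.isIntegral_coeff_of_sq {B N : Type*} [CommRing B] [CommMonoid N]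
    [UniqueProds N] (A : Subring B) (f : MonoidAlgebra B N)
    (h : ∀ n, (f ^ 2).coeff n ∈ A) (n : N) : IsIntegral A (f.coeff n) := by
  refine isIntegral_of_forall_prime A _ fun q hq => ?_
  let φ : B →+* q.ResidueField := algebraMap B q.ResidueField
  have := isIntegral_coeff_of_coeff_sq_mem (A.map φ) (MonoidAlgebra.mapRingHom N φ f) (by
    intro m
    rw [← map_pow, MonoidAlgebra.coeff_mapRingHom]
    exact ⟨_, h m, rfl⟩) n
  rw [MonoidAlgebra.coeff_mapRingHom] at this
  obtain ⟨p, hp, hp0⟩ := this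
  let ψ : A →+* A.map φ := (φ.comp A.subtype).codRestrict _ fun a => ⟨a, a.2, rfl⟩
  have hψ : Function.Surjective ψ := by
    rintro ⟨_, a, ha, rfl⟩
    exact ⟨⟨a, ha⟩, rfl⟩
  -- The monic relation over the image of `A` lifts to a monic polynomial over `A`, whose value then
  -- lies in `q`.
  obtain ⟨p', hp'1, -, hp'2⟩ := Polynomial.lifts_and_degree_eq_and_monic
    ((Polynomial.lifts_iff_coeff_lifts p).2 fun i => hψ _) hp
  refine ⟨p', hp'2, ?_⟩
  have : φ (Polynomial.aeval (f.coeff n) p') = 0 := by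
    rw [← hp0, ← hp'1, Polynomial.eval₂_map, Polynomial.aeval_def, Polynomial.hom_eval₂]
    rfl
  exact (Ideal.algebraMap_residueField_eq_zero (I := q)).1 this

theorem MonoidAlgebra.exists_pow_mem_of_sq {k N : Type*} [CommRing k] [IsDomain k] [CommMonoid N]
    [IsCancelMul N] [UniqueProds N] (M : Submonoid N) (f : MonoidAlgebra k N)
    (h : ∀ n, (f ^ 2).coeff n ≠ 0 → n ∈ M) {x : N} (hx : f.coeff x ≠ 0) :
    ∃ r : ℕ, 1 ≤ r ∧ x ^ r ∈ M := by
  let R := (monoidAlgebraInclusion (⊤ : Subring k) M).range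
  -- The comultiplication: the coefficient of `δ f` at `n` is the monomial `f_n · n`, so integrality
  -- of coefficients over `k[M]` becomes a statement about `n` itself.
  let δ : MonoidAlgebra k N →ₐ[k] MonoidAlgebra (MonoidAlgebra k N) N :=
    MonoidAlgebra.lift k _ N
      { toFun := fun n => single n (single n 1)
        map_one' := rfl
        map_mul' := fun a b => by simp }
  have hδ : ∀ (g : MonoidAlgebra k N) (n : N), (δ g).coeff n = single n (g.coeff n) := by
    classical
    intro g n
    induction g using MonoidAlgebra.induction_linear with
    | zero => simp
    | add a b ha hb => simp [ha, hb]
    | single m r =>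
      by_cases hmn : m = n <;> simp [δ, MonoidAlgebra.lift_single, hmn]
  have hint : IsIntegral R ((δ f).coeff x) := by
    refine isIntegral_coeff_of_sq R (δ f) (fun n => ?_) x
    rw [← map_pow, hδ]
    refine mem_range_monoidAlgebraInclusion.2 fun m => ⟨trivial, fun hm => ?_⟩
    by_cases hmn : m = n
    · subst hmn
      exact h m (by simpa using hm)
    · simp [Ne.symm hmn] at hm
  rw [hδ] at hint
  obtain ⟨p, hp, hp0⟩ := hint
  by_contra hcon
  push Not at hcon
  rw [Polynomial.eval₂_eq_sum_range, Finset.sum_range_succ, hp.coeff_natDegree, map_one,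
    one_mul] at hp0
  -- If no positive power of `x` lies in `M`, the term of degree `i < deg p` contributes nothing at
  -- `x ^ deg p`: that would need `x ^ (deg p - i) ∈ M`.
  have hc := congrArg (fun q => MonoidAlgebra.coeff q (x ^ p.natDegree)) hp0
  simp only [MonoidAlgebra.coeff_add, MonoidAlgebra.coeff_sum, MonoidAlgebra.single_pow,
    Finsupp.add_apply, Finsupp.finsetSum_apply, MonoidAlgebra.coeff_single, Finsupp.single_eq_same,
    MonoidAlgebra.coeff_zero, Finsupp.zero_apply] at hc
  rw [Finset.sum_eq_zero, zero_add] at hc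
  · exact pow_ne_zero _ hx hc
  · intro i hi
    have hi' := Finset.mem_range.1 hi
    have hsplit : x ^ p.natDegree = x ^ (p.natDegree - i) * x ^ i := by
      rw [← pow_add, Nat.sub_add_cancel hi'.le]
    rw [MonoidAlgebra.coeff_mul_single_eq_coeff_mul (x ^ (p.natDegree - i))]
    · have h0 : (algebraMap R (MonoidAlgebra k N) (p.coeff i)).coeff (x ^ (p.natDegree - i)) = 0 := by
        by_contra hne
        exact hcon _ (by omega)
          ((mem_range_monoidAlgebraInclusion.1 (p.coeff i).2 (x ^ (p.natDegree - i))).2 hne)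
      rw [h0, zero_mul]
    · intro m _
      rw [hsplit]
      exact mul_left_inj _

/-! ### Residue fields, and coefficients in a subintegrally closed subring. -/

theorem Subfield.coeff_mem_of_sq_of_cube {K N : Type*} [Field K] [CommMonoid N] [UniqueProds N]
    (k : Subfield K) (f : MonoidAlgebra K N) (h2 : ∀ n, (f ^ 2).coeff n ∈ k)
    (h3 : ∀ n, (f ^ 3).coeff n ∈ k) (n : N) : f.coeff n ∈ k := by
  by_contra hn
  have hlift : ∀ u : MonoidAlgebra K N, (∀ n, u.coeff n ∈ k) →
      ∃ g : MonoidAlgebra k N, MonoidAlgebra.mapRingHom N k.subtype g = u := by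
    intro u hu
    have : u ∈ Set.range (MonoidAlgebra.map (M := N) k.subtype.toAddMonoidHom) := by
      rw [MonoidAlgebra.range_map]
      exact fun i => ⟨⟨_, hu i⟩, rfl⟩
    exact this
  obtain ⟨g, hg⟩ := hlift _ h2
  obtain ⟨u, hu⟩ := hlift _ h3
  have hn' : f.coeff n ∉ (1 : Submodule k K) := by
    rw [Submodule.mem_one]
    rintro ⟨y, hy⟩
    exact hn (hy ▸ y.2)
  -- A `k`-linear functional vanishing on `k` but not at the offending coefficient; applied
  -- coefficientwise, it gives `f² · l(f) = l(f³) = 0` in the domain `k[N]`.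
  obtain ⟨l, hl, hlk⟩ := Submodule.exists_le_ker_of_notMem hn'
  have hmul : ∀ (a : MonoidAlgebra k N) (b : MonoidAlgebra K N),
      MonoidAlgebra.map l.toAddMonoidHom (MonoidAlgebra.mapRingHom N k.subtype a * b) =
        a * MonoidAlgebra.map l.toAddMonoidHom b := by
    intro a b
    induction a using MonoidAlgebra.induction_linear with
    | zero => simp
    | add a a' ha ha' => simp only [map_add, add_mul, MonoidAlgebra.map_add, ha, ha']
    | single m r =>
      induction b using MonoidAlgebra.induction_linear with
      | zero => simp
      | add b b' hb hb' => simp only [mul_add, MonoidAlgebra.map_add, hb, hb']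
      | single m' r' =>
        simp only [MonoidAlgebra.mapRingHom_single, MonoidAlgebra.single_mul_single,
          MonoidAlgebra.map_single]
        congr 1
        exact l.map_smul r r'
  have hz : g * MonoidAlgebra.map l.toAddMonoidHom f = 0 := by
    rw [← hmul, hg, ← pow_succ, ← hu]
    ext i : 2
    rw [MonoidAlgebra.coeff_map, Finsupp.mapRange_apply, MonoidAlgebra.coeff_mapRingHom]
    exact hlk (Submodule.mem_one.2 ⟨u.coeff i, rfl⟩)
  rcases mul_eq_zero.1 hz with h | h
  · rw [h, map_zero] at hg
    have := pow_eq_zero_iff two_ne_zero |>.1 hg.symm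
    rw [this] at hn
    exact hn k.zero_mem
  · have := congrArg (fun q => MonoidAlgebra.coeff q n) h
    simp at this
    exact hl this

theorem eq_of_sq_eq_of_cube_eq {R : Type*} [CommRing R] [IsReduced R] {x y : R}
    (h2 : x ^ 2 = y ^ 2) (h3 : x ^ 3 = y ^ 3) : x = y := by
  have : (x - y) ^ 3 = 0 := by linear_combination 4 * h3 - 3 * (x + y) * h2
  exact sub_eq_zero.1 (eq_zero_of_pow_eq_zero this)

/-- A prime `Q` over `p` with trivial residue extension is the kernel of a map `S → κ(p)` over `R`,
so uniqueness of such maps makes `Spec` injective. -/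
theorem RingHom.isSubintegral_of_residueField {R S : Type*} [CommRing R] [CommRing S]
    (f : R →+* S) (hf : Function.Injective f) (hint : f.IsIntegral)
    (hsurj : ∀ (Q : Ideal S) [Q.IsPrime] (s : S),
      algebraMap S Q.ResidueField s ∈
        (Ideal.ResidueField.map (Q.comap f) Q f rfl).fieldRange)
    (hext : ∀ (p : Ideal R) [p.IsPrime] (φ ψ : S →+* p.ResidueField),
      φ.comp f = ψ.comp f → φ = ψ) : f.IsSubintegral := by
  have hbij : ∀ (Q : Ideal S) [Q.IsPrime],
      Function.Bijective (Ideal.ResidueField.map (Q.comap f) Q f rfl) := by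
    intro Q _
    refine ⟨RingHom.injective _, fun y => ?_⟩
    obtain ⟨a, b, -, rfl⟩ := IsFractionRing.div_surjective (A := S ⧸ Q) y
    obtain ⟨a, rfl⟩ := Ideal.Quotient.mk_surjective a
    obtain ⟨b, rfl⟩ := Ideal.Quotient.mk_surjective b
    exact div_mem (hsurj Q a) (hsurj Q b)
  refine ⟨hf, hint, ⟨?_, hint.comap_surjective hf⟩, fun Q _ => hbij Q⟩
  have key : ∀ (p : Ideal R) [p.IsPrime] (Q : Ideal S) [Q.IsPrime], p = Q.comap f →
      ∃ φ : S →+* p.ResidueField, φ.comp f = algebraMap R p.ResidueField ∧ RingHom.ker φ = Q := by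
    intro p _ Q _ hQ
    subst hQ
    let e := RingEquiv.ofBijective _ (hbij Q)
    refine ⟨(e.symm : Q.ResidueField →+* _).comp (algebraMap S Q.ResidueField), ?_, ?_⟩
    · ext x
      simp only [RingHom.comp_apply, RingHom.coe_coe]
      rw [RingEquiv.symm_apply_eq]
      exact (Ideal.ResidueField.map_algebraMap _ _ _ rfl x).symm
    · ext x
      rw [RingHom.mem_ker, RingHom.comp_apply, RingHom.coe_coe,
        EmbeddingLike.map_eq_zero_iff, Ideal.algebraMap_residueField_eq_zero]
  intro Q₁ Q₂ h
  have h' : Q₁.asIdeal.comap f = Q₂.asIdeal.comap f := congrArg PrimeSpectrum.asIdeal h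
  obtain ⟨φ₁, h₁, hk₁⟩ := key (Q₁.asIdeal.comap f) Q₁.asIdeal rfl
  obtain ⟨φ₂, h₂, hk₂⟩ := key (Q₁.asIdeal.comap f) Q₂.asIdeal h'
  ext1
  rw [← hk₁, ← hk₂, hext _ φ₁ φ₂ (h₁.trans h₂.symm)]

theorem Subring.IsSubintegrallyClosed.coeff_mem {B N : Type*} [CommRing B] [CommMonoid N]
    [UniqueProds N] {A : Subring B} (hA : A.IsSubintegrallyClosed) (f : MonoidAlgebra B N)
    (h2 : ∀ n, (f ^ 2).coeff n ∈ A) (h3 : ∀ n, (f ^ 3).coeff n ∈ A) (n : N) :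
    f.coeff n ∈ A := by
  let X : Set B := Set.range f.coeff
  let C : Subring B := Subring.closure (A ∪ X)
  have hAC : A ≤ C := fun a ha => Subring.subset_closure (Or.inl ha)
  have hXC : ∀ m, f.coeff m ∈ C := fun m => Subring.subset_closure (Or.inr ⟨m, rfl⟩)
  let j := Subring.inclusion hAC
  -- Each condition for `A ⊂ C` to be subintegral is that some subring of `C` is everything, hence
  -- is checked on the coefficients of `f`.
  have hCT : ∀ T : Subring C, (∀ a, j a ∈ T) → (∀ m, (⟨_, hXC m⟩ : C) ∈ T) → T = ⊤ := by
    intro T hTA hTX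
    have : C ≤ T.map C.subtype := by
      rw [Subring.closure_le]
      rintro b (hb | ⟨m, rfl⟩)
      · exact ⟨_, hTA ⟨b, hb⟩, rfl⟩
      · exact ⟨_, hTX m, rfl⟩
    rw [eq_top_iff]
    rintro ⟨c, hc⟩ -
    obtain ⟨t, ht, rfl⟩ := this hc
    exact ht
  obtain ⟨g, hg⟩ : ∃ g : MonoidAlgebra C N, MonoidAlgebra.mapRingHom N C.subtype g = f := by
    have : f ∈ Set.range (MonoidAlgebra.map (M := N) C.subtype.toAddMonoidHom) := by
      rw [MonoidAlgebra.range_map]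
      exact fun i => ⟨⟨_, hXC i⟩, rfl⟩
    exact this
  have hgf : ∀ (r : ℕ) m, (((g ^ r).coeff m : C) : B) = (f ^ r).coeff m := by
    intro r m
    rw [← hg, ← map_pow, MonoidAlgebra.coeff_mapRingHom]
    rfl
  have hg1 : ∀ m, g.coeff m = ⟨_, hXC m⟩ := fun m =>
    Subtype.ext (by simpa using hgf 1 m)
  have hg2 : ∀ m, (g ^ 2).coeff m = j ⟨_, h2 m⟩ := fun m => Subtype.ext (hgf 2 m)
  have hg3 : ∀ m, (g ^ 3).coeff m = j ⟨_, h3 m⟩ := fun m => Subtype.ext (hgf 3 m)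
  refine hA.2 ⟨hAC, j.isSubintegral_of_residueField (Subring.inclusion_injective hAC) ?_ ?_ ?_⟩
    (hXC n)
  · let := j.toAlgebra
    have := hCT (integralClosure A C).toSubring (fun a => (integralClosure A C).algebraMap_mem a)
      (fun m => ?_)
    · intro c
      have hc : c ∈ (integralClosure A C).toSubring := this ▸ trivial
      exact hc
    · change IsIntegral A _
      obtain ⟨p, hp, hp0⟩ := MonoidAlgebra.isIntegral_coeff_of_sq A f h2 m
      refine ⟨p, hp, Subtype.ext ?_⟩
      exact (Polynomial.hom_eval₂ p j C.subtype _).trans hp0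
  · intro Q _ c
    set k := (Ideal.ResidueField.map (Q.comap j) Q j rfl).fieldRange with hk
    have hjk : ∀ a, algebraMap C Q.ResidueField (j a) ∈ k := fun a =>
      ⟨algebraMap _ _ a, Ideal.ResidueField.map_algebraMap _ _ _ rfl a⟩
    have := hCT (k.toSubring.comap (algebraMap C Q.ResidueField)) hjk (fun m => ?_)
    · have hc : c ∈ (k.toSubring.comap (algebraMap C Q.ResidueField)) := this ▸ trivial
      exact hc
    · have := k.coeff_mem_of_sq_of_cube
        (MonoidAlgebra.mapRingHom N (algebraMap C Q.ResidueField) g)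
        (fun i => by
          rw [← map_pow, MonoidAlgebra.coeff_mapRingHom, hg2]
          exact hjk _)
        (fun i => by
          rw [← map_pow, MonoidAlgebra.coeff_mapRingHom, hg3]
          exact hjk _) m
      rw [MonoidAlgebra.coeff_mapRingHom, hg1] at this
      exact this
  · intro p _ φ ψ hφψ
    have hj : ∀ a, φ (j a) = ψ (j a) := fun a => congrArg (fun q => q a) hφψ
    have heq : MonoidAlgebra.mapRingHom N φ g = MonoidAlgebra.mapRingHom N ψ g := by
      apply eq_of_sq_eq_of_cube_eq
      · ext i
        rw [← map_pow, ← map_pow, MonoidAlgebra.coeff_mapRingHom, MonoidAlgebra.coeff_mapRingHom,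
          hg2, hj]
      · ext i
        rw [← map_pow, ← map_pow, MonoidAlgebra.coeff_mapRingHom, MonoidAlgebra.coeff_mapRingHom,
          hg3, hj]
    have := hCT (φ.eqLocus ψ) hj (fun m => ?_)
    · exact RingHom.eq_of_eqOn_set_top fun c _ => (this ▸ trivial : c ∈ φ.eqLocus ψ)
    · have := congrArg (fun q => MonoidAlgebra.coeff q m) heq
      simp only [MonoidAlgebra.coeff_mapRingHom, hg1] at this
      exact this

/-! ### The square-cube criterion. -/

/-- Descent on the exponent: the square and cube of `s * y ^ n` involve only higher powers of `y`,
times factors `s`. -/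
theorem Subring.mul_mem_of_forall_mul_pow_mem {S : Type*} [CommRing S] {R : Subring S}
    (h : ∀ x : S, x ^ 2 ∈ R → x ^ 3 ∈ R → x ∈ R) {s y : S} (hs : s ∈ R) (n : ℕ)
    (hn : ∀ k, n ≤ k → s * y ^ k ∈ R) : s * y ∈ R := by
  induction n with
  | zero => simpa using hn 1 zero_le_one
  | succ n ih =>
    rcases Nat.eq_zero_or_pos n with rfl | hpos
    · simpa using hn 1 le_rfl
    refine ih fun k hk => ?_
    rcases hk.eq_or_lt with rfl | hk
    · refine h _ ?_ ?_
      · have : (s * y ^ n) ^ 2 = s * (s * y ^ (2 * n)) := by ring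
        rw [this]
        exact mul_mem hs (hn _ (by omega))
      · have : (s * y ^ n) ^ 3 = s ^ 2 * (s * y ^ (3 * n)) := by ring
        rw [this]
        exact mul_mem (pow_mem hs 2) (hn _ (by omega))
    · exact hn k hk

theorem RingHom.IsSubintegral.exists_mul_sub_mem {R S : Type*} [CommRing R] [CommRing S]
    {f : R →+* S} (hf : f.IsSubintegral) (Q : Ideal S) [Q.IsPrime] (y : S) :
    ∃ s r : R, f s ∉ Q ∧ f s * y - f r ∈ Q := by
  obtain ⟨e, he⟩ := (hf.bijective_residueField Q).2 (algebraMap S Q.ResidueField y)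
  obtain ⟨a, b, hb, rfl⟩ := IsFractionRing.div_surjective (A := R ⧸ Q.comap f) e
  obtain ⟨a, rfl⟩ := Ideal.Quotient.mk_surjective a
  obtain ⟨b, rfl⟩ := Ideal.Quotient.mk_surjective b
  have hb' : f b ∉ Q := fun hbQ =>
    nonZeroDivisors.ne_zero hb (Ideal.Quotient.eq_zero_iff_mem.2 hbQ)
  refine ⟨b, a, hb', ?_⟩
  have hb0 : algebraMap S Q.ResidueField (f b) ≠ 0 := fun h0 =>
    hb' (Ideal.algebraMap_residueField_eq_zero.1 h0)
  rw [Ideal.algebraMap_quotient_residueField_mk, Ideal.algebraMap_quotient_residueField_mk,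
    map_div₀, Ideal.ResidueField.map_algebraMap, Ideal.ResidueField.map_algebraMap,
    div_eq_iff hb0] at he
  rw [← Ideal.algebraMap_residueField_eq_zero, map_sub, map_mul, he]
  ring

/-- If every `x ∈ S` with `x², x³ ∈ R` lies in `R`, then `R` is subintegrally closed in `S`. -/
theorem Subring.isSubintegrallyClosed_of_sq_of_cube {S : Type*} [CommRing S] {R : Subring S}
    (h : ∀ x : S, x ^ 2 ∈ R → x ^ 3 ∈ R → x ∈ R) : R.IsSubintegrallyClosed := by
  refine ⟨⟨le_rfl, RingHom.isSubintegral_of_residueField _ (Subring.inclusion_injective _)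
    (RingHom.isIntegral_of_surjective _ fun x => ⟨x, rfl⟩)
    (fun Q _ s => ⟨algebraMap _ _ s, Ideal.ResidueField.map_algebraMap _ _ _ rfl s⟩)
    (fun p _ φ ψ hφ => RingHom.ext fun x => congrArg (fun q => q x) hφ)⟩, ?_⟩
  rintro C ⟨hRC, hsub⟩ x hxC
  by_contra hx
  let j := Subring.inclusion hRC
  have hxint : IsIntegral R x := by
    obtain ⟨p, hp, hp0⟩ := hsub.isIntegral ⟨x, hxC⟩
    exact ⟨p, hp, (Polynomial.hom_eval₂ p j C.subtype _).symm.trans (congrArg _ hp0)⟩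
  let D : Subring S := (Algebra.adjoin R {x}).toSubring
  have hRD : R ≤ D := fun r hr => (Algebra.adjoin R {x}).algebraMap_mem ⟨r, hr⟩
  have hxD : x ∈ D := Algebra.subset_adjoin rfl
  have hDC : D ≤ C := by
    intro y hy
    have hle : Algebra.adjoin R {x} ≤ ({ C with algebraMap_mem' := fun r => hRC r.2 } :
        Subalgebra R S) := Algebra.adjoin_le (by simpa using hxC)
    exact hle hy
  let i := Subring.inclusion hRD
  let k := Subring.inclusion hDC
  have hk : k.IsIntegral := RingHom.IsIntegral.tower_top i k hsub.isIntegral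
  -- The conductor of `R` in `D = R[x]`. With `p` a minimal prime over its contraction, the
  -- contradiction will be a conductor element of `R` outside `p`.
  let c : Ideal D :=
    { carrier := {z | ∀ y ∈ D, (z : S) * y ∈ R}
      add_mem' := fun ha hb y hy => by
        have := add_mem (ha y hy) (hb y hy)
        rwa [← add_mul] at this
      zero_mem' := fun y _ => by simp
      smul_mem' := fun a b hb y hy => by
        have := hb _ (mul_mem a.2 hy)
        rwa [← mul_assoc, mul_comm (b : S)] at this }
  have hc : c.comap i ≠ ⊤ := by
    rw [Ne, Ideal.eq_top_iff_one]
    intro h1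
    exact hx (by simpa using h1 x hxD)
  obtain ⟨p, hp⟩ := Ideal.nonempty_minimalPrimes hc
  have hpp : p.IsPrime := hp.1.1
  obtain ⟨P, hP⟩ := hsub.bijective_comap.2 ⟨p, hpp⟩
  have hPp : P.asIdeal.comap j = p := congrArg PrimeSpectrum.asIdeal hP
  have hmem : ∀ y : D, k y ∈ P.asIdeal → ∃ s : R, s ∉ p ∧ (s : S) * y ∈ R := by
    intro y hy
    have hex : ∃ s : R, s ∉ p ∧ ∃ n : ℕ, i s * y ^ n ∈ c := by
      by_contra hcon
      push Not at hcon
      let T : Submonoid D := p.primeCompl.map i ⊔ Submonoid.powers y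
      -- Such a `Q` contracts to `p` by minimality, so its lift to `C` is the unique prime `P` over
      -- `p`, which contains `y`.
      obtain ⟨Q, hQ, hcQ, hdis⟩ := Ideal.exists_le_prime_disjoint c T (by
        rw [Set.disjoint_left]
        rintro z hz hzT
        obtain ⟨_, ⟨s, hs, rfl⟩, _, ⟨n, rfl⟩, rfl⟩ := Submonoid.mem_sup.1 hzT
        exact hcon s hs n hz)
      obtain ⟨Q', hQ'⟩ := hk.comap_surjective (Subring.inclusion_injective _) ⟨Q, hQ⟩
      have hQQ : Q'.asIdeal.comap k = Q := congrArg PrimeSpectrum.asIdeal hQ'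
      have hle : Q.comap i ≤ p := by
        intro r hr
        by_contra hrp
        exact Set.disjoint_left.1 hdis hr (Submonoid.mem_sup_left ⟨r, hrp, rfl⟩)
      have heq : Q.comap i = p :=
        le_antisymm hle (hp.2 ⟨Ideal.IsPrime.comap i, Ideal.comap_mono hcQ⟩ hle)
      have : Q' = P := hsub.bijective_comap.1 (by
        rw [hP]
        ext1
        change Q'.asIdeal.comap j = p
        rw [← heq, ← hQQ, Ideal.comap_comap]
        rfl)
      subst this
      refine Set.disjoint_left.1 hdis (?_ : y ∈ Q)
        (Submonoid.mem_sup_right (Submonoid.mem_powers y))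
      rw [← hQQ]
      exact hy
    obtain ⟨s, hs, n, hn⟩ := hex
    refine ⟨s, hs, Subring.mul_mem_of_forall_mul_pow_mem h s.2 n fun l hl => ?_⟩
    have := hn _ (pow_mem y.2 (l - n))
    have e : (s : S) * (y : S) ^ l = ((i s * y ^ n : D) : S) * (y : S) ^ (l - n) := by
      push_cast
      rw [mul_assoc, ← pow_add, Nat.add_sub_cancel' hl]
      rfl
    rwa [e]
  have hall : ∀ y ∈ D, ∃ s : R, s ∉ p ∧ (s : S) * y ∈ R := by
    intro y hy
    obtain ⟨s, r, hs, hsr⟩ := hsub.exists_mul_sub_mem P.asIdeal (k ⟨y, hy⟩)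
    have hs' : s ∉ p := fun hsp => hs (by rw [← hPp] at hsp; exact hsp)
    obtain ⟨t, ht, htR⟩ := hmem (i s * ⟨y, hy⟩ - i r) hsr
    refine ⟨t * s, fun hts => (hpp.mem_or_mem hts).elim ht hs', ?_⟩
    have e : ((t * s : R) : S) * y = (t : S) * ((i s * ⟨y, hy⟩ - i r : D) : S) + t * r := by
      have : ((i s * ⟨y, hy⟩ - i r : D) : S) = s * y - r := rfl
      rw [this]
      push_cast
      ring
    rw [e]
    exact add_mem htR (mul_mem t.2 r.2)
  obtain ⟨G, hG⟩ := hxint.fg_adjoin_singleton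
  have hGD : ∀ g ∈ G, g ∈ D := fun g hg => by
    have : g ∈ Subalgebra.toSubmodule (Algebra.adjoin R {x}) := hG ▸ Submodule.subset_span hg
    exact this
  choose! t ht htR using fun g hg => hall g (hGD g hg)
  -- `R[x]` is a finite `R`-module, so the product of denominators of its generators lies in the
  -- conductor.
  have hs : ∏ g ∈ G, t g ∈ c.comap i := by
    intro y hy
    have hy' : y ∈ Submodule.span R (G : Set S) := by
      rw [hG]
      exact hy
    induction hy' using Submodule.span_induction with
    | mem g hg =>
      obtain ⟨u, hu⟩ := Finset.dvd_prod_of_mem t hg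
      change ((∏ g ∈ G, t g : R) : S) * g ∈ R
      rw [hu]
      push_cast
      rw [mul_right_comm]
      exact mul_mem (htR g hg) u.2
    | zero => simp
    | add a b ha hb iha ihb =>
      rw [hG] at ha hb
      rw [mul_add]
      exact add_mem (iha ha) (ihb hb)
    | smul r a ha iha =>
      rw [hG] at ha
      rw [Algebra.smul_def, mul_left_comm]
      exact mul_mem r.2 (iha ha)
  have hsp : ∏ g ∈ G, t g ∈ p := hp.1.2 hs
  obtain ⟨g, hg, hgp⟩ := (hpp.prod_mem_iff).1 hsp
  exact ht g hg hgp

/-! ### The support: faces and conductors of monoids. -/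

open Classical in
/-- The projection of `R[N]` onto the span of the monomials in a face `F` of `N`, which kills all
the other monomials. -/
noncomputable def MonoidAlgebra.faceProjection (R : Type*) {N : Type*} [CommRing R] [CommMonoid N]
    (F : Submonoid N) (hF : ∀ a b, a * b ∈ F → a ∈ F) : MonoidAlgebra R N →ₐ[R] MonoidAlgebra R N :=
  MonoidAlgebra.lift R _ N
    { toFun := fun n => if n ∈ F then single n 1 else 0
      map_one' := by simp [F.one_mem, one_def]
      map_mul' := fun a b => by
        by_cases ha : a ∈ F
        · by_cases hb : b ∈ F
          · simp [ha, hb, mul_mem]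
          · have : a * b ∉ F := fun h => hb (hF b a (mul_comm a b ▸ h))
            simp [hb, this]
        · have : a * b ∉ F := fun h => ha (hF a b h)
          simp [ha, this] }

open Classical in
theorem MonoidAlgebra.coeff_faceProjection {R N : Type*} [CommRing R] [CommMonoid N]
    (F : Submonoid N) (hF : ∀ a b, a * b ∈ F → a ∈ F) (f : MonoidAlgebra R N) (n : N) :
    (faceProjection R F hF f).coeff n = if n ∈ F then f.coeff n else 0 := by
  induction f using MonoidAlgebra.induction_linear with
  | zero => simp
  | add a b ha hb =>
    rw [map_add, coeff_add, Finsupp.add_apply, ha, hb]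
    split_ifs <;> simp
  | single m r =>
    rw [faceProjection, lift_single]
    by_cases hmn : m = n
    · subst hmn
      by_cases hm : m ∈ F <;> simp [hm]
    · by_cases hm : m ∈ F <;> simp [hm, hmn]

/-- Let `E` be the set of `y` that some element of `F` multiplies into `F`. Discarding monomials in
`E` is a `k[F]`-linear map `π`, so `π(g) g² = π(g³) = 0` in a domain. -/
theorem MonoidAlgebra.exists_mul_mem_of_sq_of_cube {k N : Type*} [CommRing k] [IsDomain k]
    [CommMonoid N] [IsCancelMul N] [UniqueProds N] (F : Submonoid N) (g : MonoidAlgebra k N)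
    (h2 : ∀ n, (g ^ 2).coeff n ≠ 0 → n ∈ F) (h3 : ∀ n, (g ^ 3).coeff n ≠ 0 → n ∈ F) {x : N}
    (hx : g.coeff x ≠ 0) : ∃ s ∈ F, s * x ∈ F := by
  classical
  let E : N → Prop := fun y => ∃ s ∈ F, s * y ∈ F
  have hE : ∀ y m, m ∈ F → (E (y * m) ↔ E y) := by
    intro y m hm
    constructor
    · rintro ⟨s, hs, h⟩
      exact ⟨s * m, mul_mem hs hm, by rwa [mul_assoc, mul_comm m y]⟩
    · rintro ⟨s, hs, h⟩
      exact ⟨s, hs, by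
        rw [← mul_assoc]
        exact mul_mem h hm⟩
  let π : MonoidAlgebra k N → MonoidAlgebra k N := fun u => .ofCoeff (u.coeff.filter fun y => ¬ E y)
  have hπ : ∀ u n, (π u).coeff n = if E n then 0 else u.coeff n := fun u n =>
    (Finsupp.filter_apply _ _ _).trans (ite_not _ _ _)
  have hadd : ∀ u v, π (u + v) = π u + π v := fun u v => by
    ext n
    simp only [hπ, coeff_add, Finsupp.add_apply]
    split_ifs <;> simp
  have hzero : π 0 = 0 := by
    ext n
    simp [hπ]
  have hsing : ∀ y r, π (single y r) = if E y then 0 else single y r := by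
    intro y r
    ext n
    rw [hπ]
    by_cases hyn : y = n
    · subst hyn
      split_ifs <;> simp
    · split_ifs <;> simp [hyn]
  have hmul1 : ∀ u m r, m ∈ F → π (u * single m r) = π u * single m r := by
    intro u m r hm
    induction u using MonoidAlgebra.induction_linear with
    | zero => simp [hzero]
    | add a b ha hb => rw [add_mul, hadd, ha, hb, hadd, add_mul]
    | single y t =>
      rw [single_mul_single, hsing, hsing]
      by_cases hy : E y
      · rw [if_pos ((hE y m hm).2 hy), if_pos hy, zero_mul]
      · rw [if_neg (mt (hE y m hm).1 hy), if_neg hy, single_mul_single]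
  have hsum : ∀ (s : Finset N) (v : N → MonoidAlgebra k N), π (∑ i ∈ s, v i) = ∑ i ∈ s, π (v i) :=
    fun s v => map_sum (⟨⟨π, hzero⟩, hadd⟩ : MonoidAlgebra k N →+ MonoidAlgebra k N) v s
  have hmul : π (g * g ^ 2) = π g * g ^ 2 := by
    have e : g ^ 2 = ∑ n ∈ (g ^ 2).coeff.support, single n ((g ^ 2).coeff n) := by
      ext m
      simp [coeff_sum, Finsupp.single_apply]
    rw [e, Finset.mul_sum, Finset.mul_sum, hsum]
    exact Finset.sum_congr rfl fun n hn => hmul1 _ _ _ (h2 n (Finsupp.mem_support_iff.1 hn))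
  have hz : π (g * g ^ 2) = 0 := by
    ext n
    rw [← pow_succ', hπ]
    split_ifs with hn
    · rfl
    · by_contra h0
      exact hn ⟨1, F.one_mem, by simpa using h3 n h0⟩
  rcases mul_eq_zero.1 (hmul.symm.trans hz) with h | h
  · by_contra hxE
    have hx0 := congrArg (fun q => coeff q x) h
    rw [hπ, if_neg hxE] at hx0
    exact hx hx0
  · rw [pow_eq_zero_iff two_ne_zero] at h
    simp [h] at hx

theorem Submonoid.exists_forall_mul_mem {N : Type*} [CommMonoid N] (M F : Submonoid N)
    (hFM : F ≤ M) (hint : ∀ x : N, ∃ r : ℕ, 1 ≤ r ∧ x ^ r ∈ M) (X : Finset N)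
    (hX : ∀ x ∈ X, ∃ s ∈ F, s * x ∈ M) :
    ∃ s ∈ F, ∀ y ∈ closure ((M : Set N) ∪ X), s * y ∈ M := by
  classical
  induction X using Finset.induction_on with
  | empty => exact ⟨1, F.one_mem, fun y hy => by simpa using hy⟩
  | insert x X _ ih =>
    obtain ⟨s, hs, hsM⟩ := ih fun x hx => hX x (Finset.mem_insert_of_mem hx)
    obtain ⟨t, ht, htM⟩ := hX x (Finset.mem_insert_self x X)
    obtain ⟨r, hr, hrM⟩ := hint x
    refine ⟨s * t ^ r, mul_mem hs (pow_mem ht r), fun y hy => ?_⟩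
    have e : ((M : Set N) ∪ (insert x X : Finset N)) = ((M : Set N) ∪ X) ∪ {x} := by
      rw [Finset.coe_insert, Set.insert_eq, Set.union_comm {x}, Set.union_assoc]
    rw [e, closure_union] at hy
    obtain ⟨y', hy', _, hz, rfl⟩ := mem_sup.1 hy
    obtain ⟨a, rfl⟩ := mem_closure_singleton.1 hz
    have hb : a % r ≤ r := (Nat.mod_lt a hr).le
    -- Only the exponent of `x` modulo `r` needs help from `t`, and `t ^ r` suffices for every
    -- remainder.
    have e1 : s * t ^ r * (y' * x ^ a) =
        s * y' * ((t * x) ^ (a % r) * t ^ (r - a % r) * (x ^ r) ^ (a / r)) := by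
      conv_lhs => rw [← Nat.mod_add_div a r, ← Nat.add_sub_cancel' hb]
      simp only [Nat.add_sub_cancel' hb, pow_add, pow_mul, mul_pow]
      rw [← Nat.add_sub_cancel' hb, pow_add, Nat.add_sub_cancel' hb]
      ac_rfl
    rw [e1]
    exact mul_mem (hsM y' hy') (mul_mem (mul_mem (pow_mem htM _) (hFM (pow_mem ht _)))
      (pow_mem hrM _))

theorem Submonoid.IsSubintegrallyClosed.mem_of_forall_pow_mem {N : Type*} [CommMonoid N]
    {M : Submonoid N} (hM : M.IsSubintegrallyClosed) {z : N} (n : ℕ)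
    (hn : ∀ k, n ≤ k → z ^ k ∈ M) : z ∈ M := by
  induction n with
  | zero => simpa using hn 1 zero_le_one
  | succ n ih =>
    rcases Nat.eq_zero_or_pos n with rfl | hpos
    · simpa using hn 1 le_rfl
    refine ih fun k hk => ?_
    rcases hk.eq_or_lt with rfl | hk
    · refine hM _ ?_ ?_ <;> rw [← pow_mul] <;> exact hn _ (by omega)
    · exact hn k hk

/-- Let `T` be generated by `M` and the support, with conductor `c = {s | sT ⊂ M}`. If `x₀ ∉ M` then
`1 ∉ c`, and a submonoid `F ≤ M` maximal among those missing `c` is a face of `M`. Each support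
element is multiplied into `M` by some element of `F`; by finiteness one `s ∈ F` works for all of
`T`, so `s ∈ c`, a contradiction. -/
theorem Submonoid.IsSubintegrallyClosed.mem_of_coeff_ne_zero_of_integral {k N : Type*} [CommRing k]
    [IsDomain k] [CommMonoid N] [IsCancelMul N] [UniqueProds N] {M : Submonoid N}
    (hM : M.IsSubintegrallyClosed) (hint : ∀ x : N, ∃ r : ℕ, 1 ≤ r ∧ x ^ r ∈ M)
    (f : MonoidAlgebra k N) (h2 : ∀ n, (f ^ 2).coeff n ≠ 0 → n ∈ M)
    (h3 : ∀ n, (f ^ 3).coeff n ≠ 0 → n ∈ M) {x₀ : N} (hx₀ : f.coeff x₀ ≠ 0) : x₀ ∈ M := by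
  classical
  by_contra hx₀M
  set X := f.coeff.support with hXdef
  set T := closure ((M : Set N) ∪ X) with hT
  have hMT : M ≤ T := fun m hm => subset_closure (Or.inl hm)
  have hXT : ∀ x ∈ X, x ∈ T := fun x hx => subset_closure (Or.inr hx)
  let c : Set N := {s | ∀ y ∈ T, s * y ∈ M}
  have hcM : ∀ s ∈ c, s ∈ M := fun s hs => by simpa using hs 1 T.one_mem
  have hcT : ∀ s ∈ c, ∀ y ∈ T, s * y ∈ c := fun s hs y hy z hz => by
    rw [mul_assoc]
    exact hs _ (mul_mem hy hz)
  obtain ⟨F, -, hF⟩ := zorn_le_nonempty₀ {F : Submonoid N | F ≤ M ∧ Disjoint (F : Set N) c}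
    (by
      intro ch hch hchain y hy
      refine ⟨sSup ch, ⟨sSup_le fun G hG => (hch hG).1, ?_⟩, fun z hz => le_sSup hz⟩
      rw [Set.disjoint_left]
      intro z hz
      obtain ⟨G, hG, hzG⟩ := (mem_sSup_of_directedOn ⟨y, hy⟩ hchain.directedOn).1 hz
      exact Set.disjoint_left.1 (hch hG).2 hzG) ⊥ (by
      refine ⟨bot_le, Set.disjoint_left.2 ?_⟩
      rintro _ h1 h
      rw [SetLike.mem_coe, mem_bot] at h1
      subst h1
      exact hx₀M (by simpa using h x₀ (hXT _ (Finsupp.mem_support_iff.2 hx₀))))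
  have hFM : F ≤ M := hF.1.1
  have hFc : ∀ s ∈ F, s ∉ c := fun s hs => Set.disjoint_left.1 hF.1.2 hs
  have hmax : ∀ s ∈ M, s ∉ F → ∃ t ∈ F, ∃ n : ℕ, t * s ^ n ∈ c := by
    intro s hs hsF
    by_contra hcon
    push Not at hcon
    have := hF.2 (y := F ⊔ powers s) ⟨sup_le hFM (powers_le.2 hs), Set.disjoint_left.2 (by
      intro z hz
      obtain ⟨t, ht, _, ⟨n, rfl⟩, rfl⟩ := mem_sup.1 hz
      exact hcon t ht n)⟩ le_sup_left
    exact hsF (this (mem_sup_right (mem_powers s)))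
  have hface : ∀ a ∈ M, ∀ b ∈ M, a * b ∈ F → a ∈ F := by
    intro a ha b hb hab
    by_contra haF
    obtain ⟨t, ht, n, hn⟩ := hmax a ha haF
    refine hFc (t * (a * b) ^ n) (mul_mem ht (pow_mem hab n)) ?_
    rw [mul_pow, ← mul_assoc]
    exact hcT _ hn _ (hMT (pow_mem hb n))
  let F' : Submonoid N :=
    { carrier := {y | ∃ j : ℕ, 1 ≤ j ∧ y ^ j ∈ F}
      one_mem' := ⟨1, le_rfl, by simp⟩
      mul_mem' := by
        rintro a b ⟨j, hj, ha⟩ ⟨l, hl, hb⟩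
        refine ⟨j * l, Nat.mul_pos hj hl, ?_⟩
        rw [mul_pow, pow_mul, mul_comm j l, pow_mul]
        exact mul_mem (pow_mem ha l) (pow_mem hb j) }
  have hF'face : ∀ a b, a * b ∈ F' → a ∈ F' := by
    rintro a b ⟨j, hj, hab⟩
    obtain ⟨r, hr, ha⟩ := hint a
    obtain ⟨q, hq, hb⟩ := hint b
    refine ⟨r * q * j, Nat.mul_pos (Nat.mul_pos hr hq) hj,
      hface _ ?_ (b ^ (r * q * j)) ?_ ?_⟩
    · rw [mul_assoc, pow_mul]
      exact pow_mem ha _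
    · rw [mul_comm r q, mul_assoc, pow_mul]
      exact pow_mem hb _
    · rw [← mul_pow, mul_comm (r * q), pow_mul]
      exact pow_mem hab _
  have hF'M : ∀ y ∈ M, y ∈ F' → y ∈ F := by
    rintro y hy ⟨j, hj, hyj⟩
    refine hface y hy (y ^ (j - 1)) (pow_mem hy _) ?_
    rwa [← pow_succ', Nat.sub_add_cancel hj]
  have hproj : ∀ r : ℕ, (∀ n, (f ^ r).coeff n ≠ 0 → n ∈ M) →
      ∀ n, ((MonoidAlgebra.faceProjection k F' hF'face f) ^ r).coeff n ≠ 0 → n ∈ F := by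
    intro r hr n hn
    rw [← map_pow, MonoidAlgebra.coeff_faceProjection] at hn
    split_ifs at hn with hnF
    · exact hF'M n (hr n hn) hnF
    · exact (hn rfl).elim
  have hX : ∀ x ∈ X, ∃ s ∈ F, s * x ∈ M := by
    intro x hxX
    have hx := Finsupp.mem_support_iff.1 hxX
    by_cases hxF : x ∈ F'
    · obtain ⟨s, hs, hsx⟩ := MonoidAlgebra.exists_mul_mem_of_sq_of_cube F
        (MonoidAlgebra.faceProjection k F' hF'face f) (hproj 2 h2) (hproj 3 h3) (x := x) (by
          rwa [MonoidAlgebra.coeff_faceProjection, if_pos hxF])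
      exact ⟨s, hs, hFM hsx⟩
    · obtain ⟨r, hr, hrM⟩ := hint x
      -- Here `x ^ r ∈ M` lies outside `F`, so maximality gives `t * x ^ (r * n) ∈ c`, and all high
      -- powers of `t * x` lie in `M`.
      obtain ⟨t, ht, n, hn⟩ := hmax (x ^ r) hrM fun h => hxF ⟨r, hr, h⟩
      rw [← pow_mul] at hn
      refine ⟨t, ht, hM.mem_of_forall_pow_mem (r * n) fun l hl => ?_⟩
      rcases Nat.eq_zero_or_pos (r * n) with h0 | hpos
      · rw [h0, pow_zero, mul_one] at hn
        exact (hFc t ht hn).elim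
      have e : (t * x) ^ l = t * x ^ (r * n) * (t ^ (l - 1) * x ^ (l - r * n)) := by
        calc (t * x) ^ l = t ^ (1 + (l - 1)) * x ^ (r * n + (l - r * n)) := by
              rw [mul_pow, Nat.add_sub_cancel' hl, Nat.add_sub_cancel' (hpos.trans_le hl)]
          _ = _ := by
              rw [pow_add, pow_add, pow_one]
              ac_rfl
      rw [e]
      exact hn _ (mul_mem (hMT (hFM (pow_mem ht _))) (pow_mem (hXT x hxX) _))
  obtain ⟨s, hs, hsc⟩ := exists_forall_mul_mem M F hFM hint X hX
  exact hFc s hs hsc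

/-- The elements with a power in `M` form a submonoid containing the support, which reduces to the
integral case. -/
theorem Submonoid.IsSubintegrallyClosed.mem_of_coeff_ne_zero {k N : Type*} [CommRing k]
    [IsDomain k] [CommMonoid N] [IsCancelMul N] [UniqueProds N] {M : Submonoid N}
    (hM : M.IsSubintegrallyClosed) (f : MonoidAlgebra k N)
    (h2 : ∀ n, (f ^ 2).coeff n ≠ 0 → n ∈ M) (h3 : ∀ n, (f ^ 3).coeff n ≠ 0 → n ∈ M) {x : N}
    (hx : f.coeff x ≠ 0) : x ∈ M := by
  let N' : Submonoid N :=
    { carrier := {y | ∃ r : ℕ, 1 ≤ r ∧ y ^ r ∈ M}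
      one_mem' := ⟨1, le_rfl, by simp⟩
      mul_mem' := by
        rintro a b ⟨j, hj, ha⟩ ⟨l, hl, hb⟩
        refine ⟨j * l, Nat.mul_pos hj hl, ?_⟩
        rw [mul_pow, pow_mul, mul_comm j l, pow_mul]
        exact mul_mem (pow_mem ha l) (pow_mem hb j) }
  have hN' : ∀ n, f.coeff n ≠ 0 → n ∈ N' := fun n hn =>
    MonoidAlgebra.exists_pow_mem_of_sq M f h2 hn
  have : UniqueProds N' :=
    UniqueProds.of_injective_mulHom N'.subtype.toMulHom Subtype.val_injective inferInstance
  obtain ⟨g, hg⟩ : ∃ g, MonoidAlgebra.mapDomainRingHom k N'.subtype g = f :=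
    ⟨_, MonoidAlgebra.mapDomain_comapDomain (f := N'.subtype) (x := f) (fun n hn =>
      ⟨⟨n, hN' n (Finsupp.mem_support_iff.1 hn)⟩, rfl⟩) Subtype.val_injective⟩
  have hcoeff : ∀ (r : ℕ) (n : N'), (g ^ r).coeff n = (f ^ r).coeff n := by
    intro r n
    rw [← hg, ← map_pow]
    exact (Finsupp.mapDomain_apply Subtype.val_injective (g ^ r).coeff n).symm
  have := mem_of_coeff_ne_zero_of_integral (M := M.comap N'.subtype) (x₀ := ⟨x, hN' x hx⟩)
    (fun y hy2 hy3 => hM y hy2 hy3) (fun y => y.2) g (fun n hn => h2 n (by rwa [← hcoeff]))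
    (fun n hn => h3 n (by rwa [← hcoeff])) (by
      have := hcoeff 1 ⟨x, hN' x hx⟩
      rw [pow_one, pow_one] at this
      rwa [this])
  exact this

/-! ### The square-cube property of `A[M]` in `B[N]`. -/

theorem mem_range_monoidAlgebraInclusion_of_sq_of_cube {B : Type*} [CommRing B] [IsReduced B]
    {A : Subring B} {N : Type*} [CommMonoid N] [IsCancelMul N] [UniqueProds N] {M : Submonoid N}
    (hA : A.IsSubintegrallyClosed) (hM : M.IsSubintegrallyClosed) (f : MonoidAlgebra B N)
    (h2 : f ^ 2 ∈ (monoidAlgebraInclusion A M).range)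
    (h3 : f ^ 3 ∈ (monoidAlgebraInclusion A M).range) :
    f ∈ (monoidAlgebraInclusion A M).range := by
  rw [mem_range_monoidAlgebraInclusion] at h2 h3 ⊢
  refine fun n => ⟨hA.coeff_mem f (fun i => (h2 i).1) (fun i => (h3 i).1) n, fun hn => ?_⟩
  obtain ⟨q, hq, hnq⟩ : ∃ q : Ideal B, q.IsPrime ∧ f.coeff n ∉ q := by
    by_contra hcon
    push Not at hcon
    exact hn (nilpotent_iff_mem_prime.2 hcon).eq_zero
  have hmap : ∀ r : ℕ, (∀ i, (f ^ r).coeff i ∈ A ∧ ((f ^ r).coeff i ≠ 0 → i ∈ M)) →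
      ∀ i, ((MonoidAlgebra.mapRingHom N (Ideal.Quotient.mk q) f) ^ r).coeff i ≠ 0 → i ∈ M := by
    intro r hr i hi
    rw [← map_pow, MonoidAlgebra.coeff_mapRingHom] at hi
    exact (hr i).2 fun h0 => hi (by rw [h0, map_zero])
  refine hM.mem_of_coeff_ne_zero (MonoidAlgebra.mapRingHom N (Ideal.Quotient.mk q) f) (hmap 2 h2)
    (hmap 3 h3) ?_
  rw [MonoidAlgebra.coeff_mapRingHom]
  exact fun h0 => hnq (Ideal.Quotient.eq_zero_iff_mem.1 h0)

/-! ### Quotients by radical monoid ideals. -/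

namespace SemigroupIdeal

theorem mem_algebraIdeal {R N : Type*} [CommRing R] [CommMonoid N] {I : SemigroupIdeal N}
    {f : MonoidAlgebra R N} : f ∈ I.algebraIdeal R ↔ ∀ n, f.coeff n ≠ 0 → n ∈ I := by
  rw [algebraIdeal, MonoidAlgebra.mem_ideal_span_of_image]
  refine forall_congr' fun n => ?_
  rw [Finsupp.mem_support_iff]
  refine imp_congr_right fun _ => ⟨?_, fun hn => ⟨n, hn, 1, (one_mul n).symm⟩⟩
  rintro ⟨m, hm, d, rfl⟩
  exact I.mul_mem d hm

end SemigroupIdeal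

theorem monoidQuotientMap_injective {B N : Type*} [CommRing B] [CommMonoid N]
    (A : Subring B) (M : Submonoid N) (I : SemigroupIdeal N) :
    Function.Injective (monoidQuotientMap A M I) := by
  refine Ideal.quotientMap_injective' fun g hg => ?_
  rw [Ideal.mem_comap, SemigroupIdeal.mem_algebraIdeal] at hg
  rw [SemigroupIdeal.mem_algebraIdeal]
  intro m hm
  refine hg m ?_
  rw [coeff_monoidAlgebraInclusion]
  exact fun h => hm (Subtype.ext h)

/-- The smallest face of a commutative monoid containing a given element. -/
def Submonoid.faceOf {N : Type*} [CommMonoid N] (n : N) : Submonoid N where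
  carrier := {x | ∃ (k : ℕ) (y : N), x * y = n ^ k}
  one_mem' := ⟨0, 1, by simp⟩
  mul_mem' := by
    rintro a b ⟨k, y, ha⟩ ⟨l, z, hb⟩
    exact ⟨k + l, y * z, by rw [mul_mul_mul_comm, ha, hb, pow_add]⟩

theorem Submonoid.mem_faceOf_of_mul_mem {N : Type*} [CommMonoid N] (n a b : N)
    (h : a * b ∈ faceOf n) : a ∈ faceOf n := by
  obtain ⟨k, y, h⟩ := h
  exact ⟨k, b * y, by rw [← mul_assoc, h]⟩

theorem SemigroupIdeal.IsRadicalIdeal.notMem_of_mem_faceOf {N : Type*} [CommMonoid N]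
    {I : SemigroupIdeal N} (hI : I.IsRadicalIdeal) {n x : N} (hn : n ∉ I)
    (hx : x ∈ Submonoid.faceOf n) : x ∉ I := by
  rintro hxI
  obtain ⟨k, y, h⟩ := hx
  have hk : n ^ k ∈ I := by
    rw [← h, mul_comm]
    exact I.mul_mem y hxI
  -- The extra factor `n` covers `k = 0`, since the radical requires a positive exponent.
  have hk' : n ^ (k + 1) ∈ I := by
    rw [pow_succ']
    exact I.mul_mem n hk
  have : n ∈ I.rad := ⟨k + 1, by omega, hk'⟩
  rw [← hI] at this
  exact hn this

theorem lemma4p7 {B : Type*} [CommRing B] [IsReduced B] (A : Subring B)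
    {N : Type*} [CommMonoid N] [IsAffineMonoid N] (M : Submonoid N) [IsAffineMonoid M]
    (hA : A.IsSubintegrallyClosed) (hM : M.IsSubintegrallyClosed)
    (I : SemigroupIdeal N) (hI : I.IsRadicalIdeal) :
    Function.Injective (monoidQuotientMap A M I) ∧
      (monoidQuotientMap A M I).range.IsSubintegrallyClosed := by
  classical
  refine ⟨monoidQuotientMap_injective A M I, Subring.isSubintegrallyClosed_of_sq_of_cube ?_⟩
  -- Affine monoids are cancellative and torsion-free, which gives unique products.
  have : UniqueProds N := by
    let _ : CancelCommMonoid N := { ‹CommMonoid N›, (inferInstance : IsCancelMul N) with }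
    have : TwoUniqueProds N := inferInstance
    infer_instance
  intro x hx2 hx3
  obtain ⟨f, rfl⟩ := Ideal.Quotient.mk_surjective x
  have hproj : ∀ r : ℕ, Ideal.Quotient.mk (I.algebraIdeal B) f ^ r ∈
      (monoidQuotientMap A M I).range →
      ∀ n ∉ I, (MonoidAlgebra.faceProjection B (Submonoid.faceOf n)
        (Submonoid.mem_faceOf_of_mul_mem n) f) ^ r ∈ (monoidAlgebraInclusion A M).range := by
    rintro r ⟨y, hy⟩ n hn
    obtain ⟨a, rfl⟩ := Ideal.Quotient.mk_surjective y
    -- The representative `a` and `f ^ r` differ by an element of `I B[N]`, invisible on the face of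
    -- `n`.
    have hsub : monoidAlgebraInclusion A M a - f ^ r ∈ I.algebraIdeal B := by
      rw [← Ideal.Quotient.eq, map_pow, ← hy]
      rfl
    rw [SemigroupIdeal.mem_algebraIdeal] at hsub
    rw [← map_pow, mem_range_monoidAlgebraInclusion]
    intro m
    rw [MonoidAlgebra.coeff_faceProjection]
    split_ifs with hm
    · have h0 : (monoidAlgebraInclusion A M a).coeff m = (f ^ r).coeff m := by
        by_contra hne
        exact hI.notMem_of_mem_faceOf hn hm (hsub m (by simpa [sub_eq_zero] using hne))
      rw [← h0]
      exact mem_range_monoidAlgebraInclusion.1 ⟨a, rfl⟩ m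
    · exact ⟨A.zero_mem, fun h => (h rfl).elim⟩
  have hf : ∀ n ∉ I, f.coeff n ∈ A ∧ (f.coeff n ≠ 0 → n ∈ M) := by
    intro n hn
    have := mem_range_monoidAlgebraInclusion.1 (mem_range_monoidAlgebraInclusion_of_sq_of_cube
      hA hM _ (hproj 2 hx2 n hn) (hproj 3 hx3 n hn)) n
    rwa [MonoidAlgebra.coeff_faceProjection, if_pos ⟨1, 1, by simp⟩] at this
  -- Dropping the monomials in `I` does not change the class of `f`.
  let f₀ : MonoidAlgebra B N := .ofCoeff (f.coeff.filter (· ∉ I))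
  have hf₀ : ∀ n, f₀.coeff n = if n ∉ I then f.coeff n else 0 := Finsupp.filter_apply _ _
  obtain ⟨a, ha⟩ : f₀ ∈ (monoidAlgebraInclusion A M).range := by
    refine mem_range_monoidAlgebraInclusion.2 fun n => ?_
    rw [hf₀]
    split_ifs with hn
    · exact ⟨A.zero_mem, fun h => (h rfl).elim⟩
    · exact hf n hn
  refine ⟨Ideal.Quotient.mk _ a, ?_⟩
  change Ideal.Quotient.mk _ (monoidAlgebraInclusion A M a) = _
  rw [ha, Ideal.Quotient.eq, SemigroupIdeal.mem_algebraIdeal]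
  intro n hn
  by_contra hnI
  refine hn ?_
  rw [MonoidAlgebra.coeff_sub, Finsupp.sub_apply, hf₀, if_pos hnI, sub_self]
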